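/- Consider the billiard in the square $[0,\tfrac12]\times[0,\tfrac12]$ with a vertical one-sided mirror $I$ joining $(a,0)$ to $(a,b)$ (trajectories pass through $I$ from its left side and are reflected by its right side), where $a=\tfrac14$ and $0<b\le\tfrac12$. For a direction $\theta\in\mathbb S^1$ put $t=\tan\theta$. Unfolding the table to the unit torus, $I$ and its mirror image in the bottom side form a slit of length $2b$, and the first return map to the section $x=\tfrac14$ is, in a suitable coordinate $y\in[0,1)$, the double rotation $$T_\theta(y)=\begin{cases} y+\tfrac{t}{2} \pmod 1, & y\in[0,2b),\\ y+t \pmod 1, & y\in[2b,1).\end{cases}$$ Call $\theta$ exceptional if some billiard orbit in direction $\theta$ goes from an end point of $I$ to an end point of $I$; that is, if $\cos\theta=0$, or there are $u,v\in\{0,b,-b\}$ and an integer $n\ge1$ with $u+n\,\tfrac t2\equiv v \pmod 1$. Consider the following four conditions, where $k,k'$ are non-negative integers and $l,l'$ are integers. $(U_{\rm odd})$ There are $k,l$ with $t\in\left(\frac{2l}{2k+1},\frac{2l+4b}{2k+1}\right)$ such that for each $k'<k$ there is $l'$ with $t\in\left(\frac{l'+2b}{k'+1},\frac{l'+1}{k'+1}\right)$.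 $(L_{\rm odd})$ There are $k,l$ with $t\in\left(\frac{2l+2-4b}{2k+1},\frac{2l+2}{2k+1}\right)$ such that for each $k'<k$ there is $l'$ with $t\in\left(\frac{l'+1}{k'+1},\frac{l'+2-2b}{k'+1}\right)$. $(U_{\rm even})$ There are $k,l$ with $t\in\left(\frac{l+1}{k+1},\frac{l+1+2b}{k+1}\right)$ such that for each $k'\le k$ there is $l'$ with $t\in\left(\frac{2l'+4b}{2k'+1},\frac{2l'+2}{2k'+1}\right)$. $(L_{\rm even})$ There are $k,l$ with $t\in\left(\frac{l+1-2b}{k+1},\frac{l+1}{k+1}\right)$ such that for each $k'\le k$ there is $l'$ with $t\in\left(\frac{2l'}{2k'+1},\frac{2l'+2-4b}{2k'+1}\right)$. (They say that the backward orbit of one of the two end points $2b$ ($U$) and $0$ ($L$) of the slit, now placed at the heights $[0,2b]$, first meets the slit after an odd, respectively even, number of half-turns of the torus.) Let $A_1$ be the set of non-exceptional $\theta$ that satisfy $(U_{\rm odd})$ and $(L_{\rm odd})$, and let $A_2$ be the set of non-exceptional $\theta$ that satisfy $(U_{\rm odd})$ and $(L_{\rm even})$, or $(U_{\rm even})$ and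 $(L_{\rm odd})$. If $\theta\in A_1\cup A_2$, then $T_\theta$ is uniquely ergodic: there is exactly one $T_\theta$-invariant Borel probability measure on $[0,1)$. -/

import Mathlib

open MeasureTheory Set

noncomputable section

/-- The double rotation of the circle `[0,1)`:
`y ↦ y + α (mod 1)` on `[0,c)` and `y ↦ y + β (mod 1)` on `[c,1)`. -/
def doubleRotation (α β c : ℝ) (y : Ico (0 : ℝ) 1) : Ico (0 : ℝ) 1 :=
  if (y : ℝ) < c then
    ⟨Int.fract ((y : ℝ) + α), Int.fract_nonneg _, Int.fract_lt_one _⟩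
  else
    ⟨Int.fract ((y : ℝ) + β), Int.fract_nonneg _, Int.fract_lt_one _⟩

/-- The double rotation `T_{(a,b,θ)}` of the billiard in the square `[0,1/2] × [0,1/2]` with a
one-sided mirror `I` from `(a,0)` to `(a,b)`, in direction `θ`.

The table unfolds to the unit torus, in which `I` together with its reflection in the bottom side
is the slit of heights `[-b,b]`, of length `2b`, over `x = a` (transparent copy) and over
`x = 1 - a` (reflecting copy). A trajectory leaving the section `x = a` at height `h` arrives at
`x = 1 - a` at height `h + (1 - 2a) tan θ`. If this lies on the slit, it jumps back to `x = a` at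
that height, and otherwise it returns to `x = a` at height `h + tan θ`. The coordinate on the
section is `y = h + (1 - 2a) tan θ + b (mod 1)`, so that the points that hit the mirror are those
of `[0, 2b)`. -/
def billiardRotation (a b : ℝ) (θ : Real.Angle) : Ico (0 : ℝ) 1 → Ico (0 : ℝ) 1 :=
  doubleRotation ((1 - 2 * a) * θ.tan) θ.tan (2 * b)

/-- Exceptional directions for the mirror at `a = 1/4`: some billiard orbit in direction `θ` goes
from an end point of the mirror to an end point of the mirror.

A vertical orbit runs along the mirror. In the unfolded torus the copies of the end points of the
mirror are at the heights `0` (for `(1/4,0)`) and `±b` (for `(1/4,b)`) over `x = 1/4` and over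
`x = 3/4`. Between two consecutive crossings of these two circles an orbit gains the height
`(tan θ)/2`, whether or not it jumps at the slit (a jump keeps the height). -/
def IsExceptional (b : ℝ) (θ : Real.Angle) : Prop :=
  θ.cos = 0 ∨
    ∃ u ∈ ({0, b, -b} : Set ℝ), ∃ v ∈ ({0, b, -b} : Set ℝ), ∃ n : ℕ, 1 ≤ n ∧
      ∃ j : ℤ, u + (n : ℝ) * (θ.tan / 2) = v + (j : ℝ)

/-! With the slit moved to the heights `[0,2b]`, its end points are `2b` and `0`. Going back along
an orbit from such an end point (on the reflecting copy) by `m` half-turns leads to the height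
`2b - m (tan θ)/2`, respectively `- m (tan θ)/2`, modulo `1`, on the transparent copy of the circle
for odd `m` and on the reflecting copy for even `m`. The following four conditions on `t = tan θ`
say which copy of the slit is met first. -/

/-- Going back from the end point `2b`, the slit is met after `2k+1` half-turns, and after no
smaller even number `2(k'+1)` of half-turns. -/
def UpperOdd (b t : ℝ) : Prop :=
  ∃ (k : ℕ) (l : ℤ),
    t ∈ Ioo (2 * (l : ℝ) / (2 * k + 1)) ((2 * (l : ℝ) + 4 * b) / (2 * k + 1)) ∧
    ∀ k' : ℕ, k' < k → ∃ l' : ℤ,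
      t ∈ Ioo (((l' : ℝ) + 2 * b) / (k' + 1)) (((l' : ℝ) + 1) / (k' + 1))

/-- Going back from the end point `0`, the slit is met after `2k+1` half-turns, and after no
smaller even number `2(k'+1)` of half-turns. -/
def LowerOdd (b t : ℝ) : Prop :=
  ∃ (k : ℕ) (l : ℤ),
    t ∈ Ioo ((2 * (l : ℝ) + 2 - 4 * b) / (2 * k + 1)) ((2 * (l : ℝ) + 2) / (2 * k + 1)) ∧
    ∀ k' : ℕ, k' < k → ∃ l' : ℤ,
      t ∈ Ioo (((l' : ℝ) + 1) / (k' + 1)) (((l' : ℝ) + 2 - 2 * b) / (k' + 1))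

/-- Going back from the end point `2b`, the slit is met after `2(k+1)` half-turns, and after no
smaller odd number `2k'+1` of half-turns. -/
def UpperEven (b t : ℝ) : Prop :=
  ∃ (k : ℕ) (l : ℤ),
    t ∈ Ioo (((l : ℝ) + 1) / (k + 1)) (((l : ℝ) + 1 + 2 * b) / (k + 1)) ∧
    ∀ k' : ℕ, k' ≤ k → ∃ l' : ℤ,
      t ∈ Ioo ((2 * (l' : ℝ) + 4 * b) / (2 * k' + 1)) ((2 * (l' : ℝ) + 2) / (2 * k' + 1))

/-- Going back from the end point `0`, the slit is met after `2(k+1)` half-turns, and after no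
smaller odd number `2k'+1` of half-turns. -/
def LowerEven (b t : ℝ) : Prop :=
  ∃ (k : ℕ) (l : ℤ),
    t ∈ Ioo (((l : ℝ) + 1 - 2 * b) / (k + 1)) (((l : ℝ) + 1) / (k + 1)) ∧
    ∀ k' : ℕ, k' ≤ k → ∃ l' : ℤ,
      t ∈ Ioo (2 * (l' : ℝ) / (2 * k' + 1)) ((2 * (l' : ℝ) + 2 - 4 * b) / (2 * k' + 1))

/-- The set `A₁` of non-exceptional directions. -/
def setA1 (b : ℝ) : Set Real.Angle :=
  {θ | UpperOdd b θ.tan ∧ LowerOdd b θ.tan} \ {θ | IsExceptional b θ}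

/-- The set `A₂` of non-exceptional directions. -/
def setA2 (b : ℝ) : Set Real.Angle :=
  {θ | (UpperOdd b θ.tan ∧ LowerEven b θ.tan) ∨ (UpperEven b θ.tan ∧ LowerOdd b θ.tan)} \
    {θ | IsExceptional b θ}

/-- Unique ergodicity: there is exactly one invariant Borel probability measure. -/
def IsUniquelyErgodic {X : Type*} [MeasurableSpace X] (T : X → X) : Prop :=
  ∃! μ : Measure X, IsProbabilityMeasure μ ∧ MeasurePreserving T μ μ

end

/-!
The billiard map moves a point by `α = (tan θ) / 2` on the slit `C = [0, 2b)` and by `2α` off it,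
so it is `R` on `C` and `R ∘ R` off `C`, where `R` is the rotation by `α`. A direction that is not
exceptional has `α` irrational: otherwise the orbit of the end point `0` returns to `0`. Hence `R`
is uniquely ergodic and every backward `R`-orbit meets `C`, and these two facts suffice.

For a measure `ν` put `ν' = ν + R_* (ν|Cᶜ)`. This is the measure of the two-level tower in which the
points off `C` climb to a second level before they come back; its projection to the circle satisfies
`R_* ν' = T_* ν + R_* (ν|Cᶜ)` (`map_add_map_restrict_compl`). So if `ν` is `T`-invariant, then `ν'`
is `R`-invariant, hence a multiple `k • m` of Lebesgue measure `m`, that is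
`ν A + ν (R⁻¹ A ∩ Cᶜ) = k * m A`. On `R C` the second term vanishes, and
inductively `ν / k` is determined on `R^n C` for every `n ≥ 1`. These sets cover the circle, so
`ν / k` is determined, and so is `ν` by its total mass (`invariant_eq`).

For existence, let `S` be the set of points whose backward orbit first meets `C` after an odd number
of steps. Then `Sᶜ = R (S \ C)`, so `ν = m|S` has `ν' = m|S + m|Sᶜ = m`, and the same identity shows
that `m|S` is `T`-invariant (`exists_invariant`).
-/

open MeasureTheory Set Function

/-! ### Maps that skip a step of a uniquely ergodic system -/

section SkipMap

variable {X : Type*} [MeasurableSpace X] (R : X ≃ᵐ X) (C : Set X)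

open Classical in
/-- The map that applies `R` once on `C` and twice off `C`. -/
noncomputable def skipMap (x : X) : X := if x ∈ C then R x else R (R x)

variable {R C}

lemma measurable_skipMap (hC : MeasurableSet C) : Measurable (skipMap R C) :=
  Measurable.ite hC R.measurable (R.measurable.comp R.measurable)

lemma map_skipMap (hC : MeasurableSet C) (ν : Measure X) :
    ν.map (skipMap R C) =
      (ν.restrict C).map R + ((ν.restrict Cᶜ).map R).map R := by
  have hT := measurable_skipMap (R := R) hC
  rw [Measure.map_map R.measurable R.measurable]
  conv_lhs => rw [← Measure.restrict_add_restrict_compl (μ := ν) hC, Measure.map_add _ _ hT]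
  congr 1
  · refine Measure.map_congr ?_
    filter_upwards [ae_restrict_mem hC] with x hx
    simp [skipMap, hx]
  · refine Measure.map_congr ?_
    filter_upwards [ae_restrict_mem hC.compl] with x hx
    simp [skipMap, show x ∉ C from hx]

/-- The projected tower measure `ν + R_* (ν|Cᶜ)` is moved by `R` as `ν` is moved by `skipMap R C`:
the second level lands where the points of `Cᶜ` land under `R ∘ R`. -/
lemma map_add_map_restrict_compl (hC : MeasurableSet C) (ν : Measure X) :
    (ν + (ν.restrict Cᶜ).map R).map R = ν.map (skipMap R C) + (ν.restrict Cᶜ).map R := by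
  rw [map_skipMap hC, Measure.map_add _ _ R.measurable]
  conv_lhs => rw [← Measure.restrict_add_restrict_compl (μ := ν) hC,
    Measure.map_add _ _ R.measurable]
  rw [Measure.restrict_add_restrict_compl (μ := ν) hC]
  abel

/-- If the tower measures of `ν` and `ν'` are `k • m` and `k' • m`, then `ν / k` and `ν' / k'` agree
on sets whose points all lie in `C` after `n + 1` backward steps. -/
lemma mul_measure_eq_mul_measure {m ν ν' : Measure X} [IsFiniteMeasure ν] [IsFiniteMeasure ν']
    {k k' : ENNReal} (hk : k ≠ ⊤) (hC : MeasurableSet C)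
    (h : ν + (ν.restrict Cᶜ).map R = k • m) (h' : ν' + (ν'.restrict Cᶜ).map R = k' • m)
    (n : ℕ) {A : Set X} (hA : MeasurableSet A) (hAC : ∀ x ∈ A, R.symm^[n + 1] x ∈ C) :
    k' * ν A = k * ν' A := by
  have tower : ∀ {ρ : Measure X} {c : ENNReal}, ρ + (ρ.restrict Cᶜ).map R = c • m →
      ∀ B, MeasurableSet B → ρ B + ρ (R ⁻¹' B ∩ Cᶜ) = c * m B := by
    intro ρ c hρ B hB
    have := congrArg (fun μ : Measure X => μ B) hρ
    simpa [R.map_apply, Measure.restrict_apply (R.measurable hB)] using this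
  induction n generalizing A with
  | zero =>
    have hempty : R ⁻¹' A ∩ Cᶜ = ∅ := by
      ext x
      simp only [mem_inter_iff, mem_preimage, mem_compl_iff, mem_empty_iff_false, iff_false]
      rintro ⟨hx, hxC⟩
      exact hxC (by simpa using hAC _ hx)
    have e := tower h A hA
    have e' := tower h' A hA
    rw [hempty, measure_empty, add_zero] at e e'
    rw [e, e', mul_left_comm]
  | succ n ih =>
    have hB : MeasurableSet (R ⁻¹' A ∩ Cᶜ) := (R.measurable hA).inter hC.compl
    have hBeq := ih hB fun x hx => by simpa [iterate_succ_apply] using hAC _ hx.1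
    have key : k' * ν A + k' * ν (R ⁻¹' A ∩ Cᶜ) = k * ν' A + k' * ν (R ⁻¹' A ∩ Cᶜ) := by
      rw [← mul_add, tower h A hA, hBeq, ← mul_add, tower h' A hA, mul_left_comm]
    refine (ENNReal.add_left_inj ?_).1 key
    rw [hBeq]
    exact ENNReal.mul_ne_top hk (measure_ne_top _ _)

variable {m : Measure X}

lemma invariant_eq [IsProbabilityMeasure m] (hC : MeasurableSet C)
    (huniq : ∀ μ : Measure X, IsFiniteMeasure μ → μ.map R = μ → ∃ k : ENNReal, μ = k • m)
    (hmeet : ∀ x, ∃ n : ℕ, R.symm^[n + 1] x ∈ C)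
    {ν ν' : Measure X} [IsProbabilityMeasure ν] [IsProbabilityMeasure ν']
    (h : ν.map (skipMap R C) = ν) (h' : ν'.map (skipMap R C) = ν') : ν = ν' := by
  obtain ⟨k, hk⟩ := huniq (ν + (ν.restrict Cᶜ).map R) inferInstance
    (by rw [map_add_map_restrict_compl hC, h])
  obtain ⟨k', hk'⟩ := huniq (ν' + (ν'.restrict Cᶜ).map R) inferInstance
    (by rw [map_add_map_restrict_compl hC, h'])
  have total := congrArg (fun μ : Measure X => μ univ) hk
  simp only [Measure.add_apply, Measure.smul_apply, measure_univ, smul_eq_mul, mul_one] at total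
  have hkt : k ≠ ⊤ := by
    rw [← total]
    exact ENNReal.add_ne_top.2 ⟨ENNReal.one_ne_top, measure_ne_top _ _⟩
  have hk0 : k ≠ 0 := by
    rw [← total]
    simp
  have prop : k' • ν = k • ν' := by
    have hV : ∀ n : ℕ, MeasurableSet (R.symm^[n + 1] ⁻¹' C) := fun n =>
      (R.symm.measurable.iterate (n + 1)) hC
    refine (Measure.ext_iff_of_iUnion_eq_univ (s := fun n => R.symm^[n + 1] ⁻¹' C) ?_).2 fun n => ?_
    · exact eq_univ_of_forall fun x => mem_iUnion.2 (hmeet x)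
    · ext A hA
      rw [Measure.restrict_apply hA, Measure.restrict_apply hA]
      exact mul_measure_eq_mul_measure hkt hC hk hk' n (hA.inter (hV n)) fun x hx => hx.2
  have hkk : k' = k := by
    have := congrArg (fun μ : Measure X => μ univ) prop
    simpa using this
  subst hkk
  ext A
  have := congrArg (fun μ : Measure X => μ A) prop
  simpa [ENNReal.mul_right_inj hk0 hkt] using this

lemma exists_invariant [IsProbabilityMeasure m] (hm : m.map R = m) (hC : MeasurableSet C)
    (hmeet : ∀ x, ∃ n : ℕ, R.symm^[n + 1] x ∈ C) :
    ∃ ν : Measure X, IsProbabilityMeasure ν ∧ ν.map (skipMap R C) = ν := by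
  classical
  -- Since `Nat.find (hmeet x) + 1` is the number of steps, an odd number of them reads `Even`.
  set S : Set X := {x | Even (Nat.find (hmeet x))} with hSdef
  have hS : MeasurableSet S :=
    (measurable_find hmeet fun k => (R.symm.measurable.iterate (k + 1)) hC)
      (MeasurableSet.of_discrete (s := {n : ℕ | Even n}))
  have hRS : R ⁻¹' Sᶜ = Cᶜ ∩ S := by
    ext y
    by_cases hy : y ∈ C
    · have : Nat.find (hmeet (R y)) = 0 := (Nat.find_eq_zero _).2 (by simpa using hy)
      simp only [hSdef, mem_preimage, mem_compl_iff, mem_ofPred_eq, mem_inter_iff, this]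
      simp [hy]
    · have : Nat.find (hmeet (R y)) = Nat.find (hmeet y) + 1 := by
        rw [Nat.find_comp_succ (hmeet (R y)) (by simpa [iterate_succ_apply] using hmeet y)
          (by simpa using hy)]
        simp [iterate_succ_apply]
      simp only [hSdef, mem_preimage, mem_compl_iff, mem_ofPred_eq, mem_inter_iff, this]
      simp only [Nat.even_add_one, not_not, hy, not_false_eq_true, true_and]
  have hlevel : ((m.restrict S).restrict Cᶜ).map R = m.restrict Sᶜ := by
    rw [Measure.restrict_restrict hC.compl, ← hRS, ← Measure.restrict_map R.measurable hS.compl, hm]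
  have hinv : (m.restrict S).map (skipMap R C) = m.restrict S := by
    have key := map_add_map_restrict_compl (R := R) hC (m.restrict S)
    rw [hlevel, Measure.restrict_add_restrict_compl hS, hm] at key
    ext A hA
    have hsum := congrArg (fun μ : Measure X => μ A)
      (key.symm.trans (Measure.restrict_add_restrict_compl (μ := m) hS).symm)
    simp only [Measure.add_apply] at hsum
    exact (ENNReal.add_left_inj (measure_ne_top _ _)).1 hsum
  have hS0 : m S ≠ 0 := by
    intro h0
    -- `Sᶜ` is the image of a part of `S`, so both would be null.
    have h1 : m Sᶜ = 0 := by
      rw [← hm, R.map_apply, hRS]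
      exact measure_mono_null inter_subset_right h0
    have h2 := measure_add_measure_compl (μ := m) hS
    simp [h0, h1] at h2
  refine ⟨(m S)⁻¹ • m.restrict S, ProbabilityTheory.cond_isProbabilityMeasure hS0, ?_⟩
  rw [Measure.map_smul, hinv]

/-- If `R` is uniquely ergodic and every backward orbit of `R` meets `C`, then `skipMap R C` is
uniquely ergodic. -/
lemma isUniquelyErgodic_skipMap [IsProbabilityMeasure m] (hm : m.map R = m)
    (hC : MeasurableSet C)
    (huniq : ∀ μ : Measure X, IsFiniteMeasure μ → μ.map R = μ → ∃ k : ENNReal, μ = k • m)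
    (hmeet : ∀ x, ∃ n : ℕ, R.symm^[n + 1] x ∈ C) :
    IsUniquelyErgodic (skipMap R C) := by
  obtain ⟨ν, hν, hinv⟩ := exists_invariant hm hC hmeet
  refine ⟨ν, ⟨hν, measurable_skipMap hC, hinv⟩, ?_⟩
  rintro ν' ⟨hν', hinv'⟩
  exact invariant_eq hC huniq hmeet hinv'.map_eq hinv

end SkipMap

lemma IsUniquelyErgodic.of_semiconj {X Y : Type*} [MeasurableSpace X] [MeasurableSpace Y]
    (e : X ≃ᵐ Y) {T : X → X} {T' : Y → Y} (h : Semiconj e T T') (hT' : IsUniquelyErgodic T') :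
    IsUniquelyErgodic T := by
  have h' : Semiconj e.symm T' T := h.inverse_left e.symm_apply_apply e.apply_symm_apply
  obtain ⟨μ, ⟨hμ, hinv⟩, huniq⟩ := hT'
  refine ⟨μ.map e.symm, ⟨Measure.isProbabilityMeasure_map e.symm.measurable.aemeasurable, ?_⟩, ?_⟩
  · have he : MeasurePreserving e.symm μ (μ.map e.symm) := ⟨e.symm.measurable, rfl⟩
    have hTe : T = e.symm ∘ T' ∘ e := by
      ext x
      simp [← h.eq x]
    rw [hTe]
    exact he.comp (hinv.comp (MeasurePreserving.symm e.symm he))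
  · rintro ν ⟨hν, hνinv⟩
    have he : MeasurePreserving e ν (ν.map e) := ⟨e.measurable, rfl⟩
    have hTe : T' = e ∘ T ∘ e.symm := by
      ext y
      simp [h.eq]
    have := huniq (ν.map e) ⟨Measure.isProbabilityMeasure_map e.measurable.aemeasurable, by
      rw [hTe]
      exact he.comp (hνinv.comp (MeasurePreserving.symm e he))⟩
    rw [← this, Measure.map_map e.symm.measurable e.measurable]
    simp

/-! ### Translations with a dense orbit on a compact group -/

section Translation

variable {G : Type*} [AddCommGroup G] [TopologicalSpace G] [IsTopologicalAddGroup G]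
  [CompactSpace G] {a : G}

lemma exists_sub_nsmul_mem (ha : DenseRange fun n : ℤ => n • a) {U : Set G} (hU : IsOpen U)
    (hne : U.Nonempty) (x : G) : ∃ n : ℕ, x - (n + 1) • a ∈ U := by
  have hd : DenseRange fun n : ℕ => n • a := denseRange_zsmul_iff_nsmul.1 ha
  have hcont : Continuous fun y : G => x - a - y := by fun_prop
  obtain ⟨u, hu⟩ := hne
  obtain ⟨n, hn⟩ := hd.exists_mem_open (hU.preimage hcont) ⟨x - a - u, by simpa using hu⟩
  refine ⟨n, ?_⟩
  simpa [add_smul, sub_sub, add_comm] using hn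

/-- A finite measure invariant under `a` is invariant under the closure of the multiples of `a`,
because translation acts continuously on integrals of continuous functions. -/
lemma isAddLeftInvariant_of_denseRange [HasOuterApproxClosed G]
    [FirstCountableTopology G] [MeasurableSpace G] [BorelSpace G]
    (ha : DenseRange fun n : ℤ => n • a) (μ : Measure G) [IsFiniteMeasure μ]
    (hμ : μ.map (a + ·) = μ) : μ.IsAddLeftInvariant := by
  have hadd : ∀ g : G, Measurable (g + ·) := fun g => (continuous_const_add g).measurable
  refine ⟨fun g => ?_⟩
  have := Measure.isFiniteMeasure_map μ (g + ·)
  refine ext_of_forall_integral_eq_of_IsFiniteMeasure fun f => ?_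
  rw [integral_map (hadd g).aemeasurable f.continuous.aestronglyMeasurable]
  have hF : Continuous fun g : G => ∫ x, f (g + x) ∂μ := by
    refine continuous_of_dominated (bound := fun _ => ‖f‖) (fun g => ?_) (fun g => ?_)
      (integrable_const _) ?_
    · exact (f.continuous.comp (continuous_const_add g)).aestronglyMeasurable
    · exact Filter.Eventually.of_forall fun x => f.norm_coe_le_norm _
    · exact Filter.Eventually.of_forall fun x => f.continuous.comp (continuous_add_const x)
  refine congrFun ((denseRange_zsmul_iff_nsmul.1 ha).equalizer hF
    (continuous_const (y := ∫ x, f x ∂μ)) ?_) g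
  ext n
  have hn : μ.map (n • a + ·) = μ := by
    have := (MeasurePreserving.mk (hadd a) hμ).iterate n
    rw [add_left_iterate] at this
    exact this.map_eq
  change ∫ x, f (n • a + x) ∂μ = ∫ x, f x ∂μ
  conv_rhs => rw [← hn]
  rw [integral_map (hadd _).aemeasurable f.continuous.aestronglyMeasurable]

end Translation

/-! ### The billiard map -/

/-- The interval `[0,1)` as the circle `ℝ/ℤ`. -/
noncomputable def icoEquivUnitAddCircle : Ico (0 : ℝ) 1 ≃ᵐ UnitAddCircle where
  toFun y := (y : ℝ)
  invFun x := ⟨AddCircle.equivIco 1 0 x, by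
    simpa only [zero_add] using (AddCircle.equivIco (1 : ℝ) 0 x).2⟩
  left_inv y := Subtype.ext (AddCircle.equivIco_coe_of_mem (by simp))
  right_inv x := AddCircle.coe_equivIco
  measurable_toFun := AddCircle.measurable_mk'.comp measurable_subtype_coe
  measurable_invFun := by
    refine Measurable.subtype_mk ?_
    exact measurable_subtype_coe.comp (AddCircle.measurableEquivIco 1 0).measurable

lemma icoEquivUnitAddCircle_apply (y : Ico (0 : ℝ) 1) :
    icoEquivUnitAddCircle y = ((y : ℝ) : UnitAddCircle) := rfl

/-- If `(tan θ) / 2` had denominator `q`, the orbit of the end point `0` would return to `0` after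
`q` half-turns. -/
lemma irrational_half_tan {b : ℝ} {θ : Real.Angle} (hθ : ¬ IsExceptional b θ) :
    Irrational (θ.tan / 2) := by
  rintro ⟨q, hq⟩
  refine hθ (Or.inr ⟨0, by simp, 0, by simp, q.den, q.den_pos, q.num, ?_⟩)
  rw [← hq, zero_add, zero_add]
  exact_mod_cast Rat.den_mul_eq_num q

lemma semiconj_doubleRotation (α c : ℝ) :
    Semiconj icoEquivUnitAddCircle (doubleRotation α (2 * α) c)
      (skipMap (MeasurableEquiv.addLeft (α : UnitAddCircle))
        (icoEquivUnitAddCircle '' {y | (y : ℝ) < c})) := by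
  intro y
  have hmem : icoEquivUnitAddCircle y ∈ icoEquivUnitAddCircle '' {y | (y : ℝ) < c} ↔
      (y : ℝ) < c := icoEquivUnitAddCircle.injective.mem_set_image
  by_cases hy : (y : ℝ) < c
  · rw [skipMap, if_pos (hmem.2 hy), doubleRotation, if_pos hy]
    simp [icoEquivUnitAddCircle_apply, add_comm]
  · rw [skipMap, if_neg (hmem.not.2 hy), doubleRotation, if_neg hy]
    simp [icoEquivUnitAddCircle_apply, two_mul, add_comm, add_left_comm]

lemma isUniquelyErgodic_doubleRotation {α c : ℝ} (hα : Irrational α) (hc : 0 < c) :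
    IsUniquelyErgodic (doubleRotation α (2 * α) c) := by
  have hdense : DenseRange fun n : ℤ => n • (α : UnitAddCircle) :=
    AddCircle.denseRange_zsmul_coe_iff.2 (by simpa using hα)
  refine .of_semiconj icoEquivUnitAddCircle (semiconj_doubleRotation α c)
    (isUniquelyErgodic_skipMap (m := AddCircle.haarAddCircle) ?_ ?_ ?_ ?_)
  · exact map_add_left_eq_self AddCircle.haarAddCircle (α : UnitAddCircle)
  · exact (MeasurableEquiv.measurableSet_image _).2 (measurable_subtype_coe measurableSet_Iio)
  · intro μ _ hμ
    have := isAddLeftInvariant_of_denseRange hdense μ hμ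
    exact ⟨_, Measure.isAddInvariant_eq_smul_of_compactSpace μ AddCircle.haarAddCircle⟩
  · intro x
    -- The slit contains a nonempty open arc.
    have hU : IsOpen ((fun r : ℝ => (r : UnitAddCircle)) '' Ioo 0 (min c 1)) :=
      QuotientAddGroup.isOpenMap_coe _ isOpen_Ioo
    have hne : ((fun r : ℝ => (r : UnitAddCircle)) '' Ioo 0 (min c 1)).Nonempty :=
      (nonempty_Ioo.2 (lt_min hc one_pos)).image _
    obtain ⟨n, r, hr, hrx⟩ := exists_sub_nsmul_mem hdense hU hne x
    refine ⟨n, ⟨r, hr.1.le, hr.2.trans_le (min_le_right _ _)⟩, hr.2.trans_le (min_le_left _ _), ?_⟩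
    have hiter : (MeasurableEquiv.addLeft (α : UnitAddCircle)).symm^[n + 1] x
        = x - (n + 1) • (α : UnitAddCircle) := by
      change (-(α : UnitAddCircle) + ·)^[n + 1] x = _
      rw [add_left_iterate]
      simp [sub_eq_add_neg, add_comm]
    rw [hiter, ← hrx, icoEquivUnitAddCircle_apply]

theorem corollary5 (b : ℝ) (hb0 : 0 < b) (hb1 : b ≤ 1 / 2) (θ : Real.Angle)
    (hθ : θ ∈ setA1 b ∪ setA2 b) :
    IsUniquelyErgodic (billiardRotation (1 / 4) b θ) := by
  have hexc : ¬ IsExceptional b θ := hθ.elim (fun h => h.2) (fun h => h.2)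
  have key := isUniquelyErgodic_doubleRotation (irrational_half_tan hexc)
    (show 0 < 2 * b by positivity)
  rw [billiardRotation]
  convert key using 2 <;> ring
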